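/- A composition is a nonempty finite list $\alpha=(a_1,\dots,a_k)$ of positive integers, of length $l(\alpha)=k$ and size $|\alpha|=a_1+\dots+a_k$. Its reversal is $\alpha^*=(a_k,\dots,a_1)$; $\alpha$ is symmetric if $\alpha=\alpha^*$, asymmetric otherwise, and lexicographic minimal if $\alpha\le\alpha^*$ in the lexicographic order. For compositions $\alpha=(a_1,\dots,a_k)$ and $\beta=(b_1,\dots,b_\ell)$ let $\alpha\cdot\beta$ denote concatenation, let $\alpha\odot\beta=(a_1,\dots,a_{k-1},a_k+b_1,b_2,\dots,b_\ell)$, let $\beta^{\odot n}=\beta\odot\dots\odot\beta$ ($n\geq1$ factors), and let $\alpha\circ\beta=\beta^{\odot a_1}\cdot\beta^{\odot a_2}\cdots\beta^{\odot a_k}$. A factorisation $\beta\circ\gamma$ is trivial if one of $\beta,\gamma$ is $(1)$, or both have length $1$, or both have all components equal to $1$. A composition is irreducible if its length is not $1$, not all its components are $1$, and all its factorisations $\beta\circ\gamma$ are trivial. An irreducible factorisation of $\alpha$ is an expression $\alpha=\alpha_1\circ\dots\circ\alpha_k$ with $k\ge1$ such that no $\alpha_i\circ\alpha_{i+1}$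 is a trivial factorisation and each $\alpha_i$ admits only trivial factorisations. A composition is normalised if all factors of its (unique) irreducible factorisation are lexicographic minimal. The Dirichlet generating function of a set $A$ of compositions is the formal Dirichlet series $A(s)=\sum_{\alpha\in A}|\alpha|^{-s}$ with integer coefficients; products and inverses of formal Dirichlet series are taken with respect to Dirichlet convolution. Let $P(s)$, $P^*(s)$, $P^\times(s)$, $R(s)$ and $S(s)$ be the Dirichlet generating functions of, respectively, the normalised irreducible compositions, the symmetric irreducible compositions, the normalised asymmetric irreducible compositions, the normalised compositions and the symmetric compositions, and let $\zeta(s)=\sum_{n\ge1}n^{-s}$. Then $S(s)=\sum_{n\ge1}2^{\lfloor n/2\rfloor}n^{-s}$, the series $\zeta(s)$, $R(s)$ and $S(s)$ are invertible, and $$P(s)=2\zeta^{-1}(s)-1-R^{-1}(s),\qquad P^*(s)=2\zeta^{-1}(s)-1-S^{-1}(s),\qquad P^\times(s)=S^{-1}(s)-R^{-1}(s).$$ -/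

import Mathlib

/-- A composition `(a₁, …, a_k)` of a positive integer: a nonempty list of positive integers. -/
@[ext]
structure Compn where
  /-- The components `a₁, …, a_k`. -/
  parts : List ℕ
  ne_nil : parts ≠ []
  pos : ∀ a ∈ parts, 0 < a

namespace Compn

/-- The size `|α| = a₁ + ⋯ + a_k`. -/
def size (α : Compn) : ℕ := α.parts.sum

/-- The length `l(α) = k`. -/
def length (α : Compn) : ℕ := α.parts.length

/-- The composition `(1)`. -/
def one : Compn where
  parts := [1]
  ne_nil := by simp
  pos := by simp

/-- Near concatenation `α ⊙ β = (a₁, …, a_k + b₁, …, b_l)`. -/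
def nearConcat (α β : Compn) : Compn where
  parts := α.parts.dropLast ++
    (α.parts.getLast α.ne_nil + β.parts.head β.ne_nil) :: β.parts.tail
  ne_nil := by simp
  pos := by
    intro a ha
    rcases List.mem_append.1 ha with h | h
    · exact α.pos a (List.mem_of_mem_dropLast h)
    · rcases List.mem_cons.1 h with h | h
      · have := α.pos _ (List.getLast_mem α.ne_nil)
        omega
      · exact β.pos a (List.mem_of_mem_tail h)

/-- `β.nearPow n = β ⊙ ⋯ ⊙ β` with `n` factors `β`. It is only used for `n ≥ 1`. -/
def nearPow (β : Compn) (n : ℕ) : Compn := (fun γ => nearConcat γ β)^[n - 1] β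

/-- The composition of compositions: for `α = (a₁, …, a_k)`, the composition `α ∘ β` is the
concatenation of the near powers `β^{⊙ a₁}, …, β^{⊙ a_k}`. -/
def comp (α β : Compn) : Compn where
  parts := α.parts.flatMap fun a => (β.nearPow a).parts
  ne_nil := by
    intro h
    rw [List.flatMap_eq_nil_iff] at h
    obtain ⟨a, ha⟩ := List.exists_mem_of_ne_nil _ α.ne_nil
    exact (β.nearPow a).ne_nil (h a ha)
  pos := by
    intro b hb
    obtain ⟨a, _, hb⟩ := List.mem_flatMap.1 hb
    exact (β.nearPow a).pos b hb

/-- The reversal `α* = (a_k, …, a₁)`. -/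
def reversal (α : Compn) : Compn where
  parts := α.parts.reverse
  ne_nil := by simpa using α.ne_nil
  pos := fun a ha => α.pos a (List.mem_reverse.1 ha)

/-- `α` is symmetric if it coincides with its reversal. -/
def IsSymmetric (α : Compn) : Prop := α = α.reversal

/-- All components of `α` are equal to `1`. -/
def AllOnes (α : Compn) : Prop := ∀ a ∈ α.parts, a = 1

/-- The factorisation `β ∘ γ` is trivial. -/
def IsTrivialPair (β γ : Compn) : Prop :=
  (β = one ∨ γ = one) ∨ (β.length = 1 ∧ γ.length = 1) ∨ (β.AllOnes ∧ γ.AllOnes)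

/-- Every factorisation `α = β ∘ γ` is trivial. -/
def OnlyTrivialFactorisations (α : Compn) : Prop :=
  ∀ β γ : Compn, α = comp β γ → IsTrivialPair β γ

/-- The irreducible compositions. -/
def IsIrreducible (α : Compn) : Prop :=
  α.length ≠ 1 ∧ ¬ α.AllOnes ∧ α.OnlyTrivialFactorisations

/-- The list `[α₁, …, α_k]`, with `k ≥ 1`, is an irreducible factorisation of `α`, that is
`α = α₁ ∘ ⋯ ∘ α_k`, no `α_i ∘ α_{i+1}` is a trivial factorisation, and each `α_i` admits only
trivial factorisations. -/
def IsIrreducibleFactorisation (fs : List Compn) (α : Compn) : Prop :=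
  fs ≠ [] ∧ α = fs.foldr comp one ∧
    fs.IsChain (fun β γ => ¬ IsTrivialPair β γ) ∧
    ∀ β ∈ fs, β.OnlyTrivialFactorisations

/-- `α ≤ α*` in the lexicographic order (note that `α` and `α*` have the same length). -/
def IsLexMinimal (α : Compn) : Prop := α.parts ≤ α.reversal.parts

/-- `α` is normalised if all factors in its irreducible factorisation are lexicographic minimal. -/
def IsNormalised (α : Compn) : Prop :=
  ∃ fs : List Compn, IsIrreducibleFactorisation fs α ∧ ∀ β ∈ fs, β.IsLexMinimal

theorem one_le_size (α : Compn) : 1 ≤ α.size := by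
  obtain ⟨a, ha⟩ := List.exists_mem_of_ne_nil _ α.ne_nil
  exact (α.pos a ha).trans_le (List.le_sum_of_mem ha)

/-- There are only finitely many compositions of size `n`, so the cardinality in `dgf` below is
a genuine one. -/
theorem finite_size_eq (n : ℕ) : {α : Compn | α.size = n}.Finite := by
  let f : {α : Compn | α.size = n} → Composition n := fun α =>
    { blocks := α.1.parts
      blocks_pos := fun {i} hi => α.1.pos i hi
      blocks_sum := α.2 }
  have hf : Function.Injective f := by
    intro α β h
    exact Subtype.ext (Compn.ext (congrArg Composition.blocks h))
  exact Set.finite_coe_iff.1 (Finite.of_injective f hf)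

/-- The formal Dirichlet generating function `A(s) = ∑_{α ∈ A} |α|^{-s}` of a set `A` of
compositions. A formal Dirichlet series `∑_{n ≥ 1} a_n n^{-s}` is represented by the arithmetic
function `n ↦ a_n`; multiplication is Dirichlet convolution. -/
noncomputable def dgf (A : Set Compn) : ArithmeticFunction ℤ where
  toFun n := ({α : Compn | α ∈ A ∧ α.size = n}.ncard : ℤ)
  map_zero' := by
    have : {α : Compn | α ∈ A ∧ α.size = 0} = ∅ := by
      ext α
      have := α.one_le_size
      simp only [Set.mem_ofPred_eq, Set.mem_empty_iff_false, iff_false]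
      omega
    simp [this]

end Compn

/-! A composition of size n is encoded by its cuts: the integers that are partial sums modulo n.
Cuts turn composition into arithmetic: at multiples of |β| the cuts of α ∘ β are those of α,
rescaled, and elsewhere they are those of β (`isCut_comp`). Hence a right factor of size d exists
exactly when d divides the size and the cuts off the multiples of d are d-periodic. By the Chinese
remainder theorem the set of such d is closed under gcd and lcm, which replaces an appeal to unique
factorisation.

Two facts about leftmost factors follow. An irreducible left factor is unique and can be cancelled
(`IsIrreducible.comp_inj`). A constant left factor (length 1, or all ones) has a well-defined kind
and a unique maximal choice (`HasConstLeft.unique`, `const_left_inj`).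

Let X be the normalised or the symmetric compositions, with series x, let p count the irreducibles
in X, and let x₀, x₁ count the members of X with a constant left factor ≠ (1) of each kind. Each
size has one constant of each kind, so removing the maximal constant gives x_b = (ζ - 1)(x - x_b),
that is x_b = (1 - ζ⁻¹)x. Sorting by the leftmost factor gives x = 1 + x₀ + x₁ + px, hence x(2ζ⁻¹ -
1 - p) = 1. This yields both the invertibility of x and the formula for p. -/

/-! ### Partial sums of lists -/

/-- `i` is a partial sum of the list `l`. -/
def IsPartialSum : List ℕ → ℕ → Prop
  | [], i => i = 0
  | a :: l, i => i = 0 ∨ (a ≤ i ∧ IsPartialSum l (i - a))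

namespace IsPartialSum

theorem zero (l : List ℕ) : IsPartialSum l 0 := by
  cases l <;> simp [IsPartialSum]

theorem le_sum {l : List ℕ} {i : ℕ} (h : IsPartialSum l i) : i ≤ l.sum := by
  induction l generalizing i with
  | nil => simpa [IsPartialSum] using h
  | cons a l ih =>
    rcases h with h | ⟨h, h'⟩
    · omega
    · have := ih h'
      simp only [List.sum_cons]
      omega

theorem sum (l : List ℕ) : IsPartialSum l l.sum := by
  induction l with
  | nil => simp [IsPartialSum]
  | cons a l ih => right; simpa using ih

theorem append (l l' : List ℕ) (i : ℕ) : IsPartialSum (l ++ l') i ↔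
    IsPartialSum l i ∨ (l.sum ≤ i ∧ IsPartialSum l' (i - l.sum)) := by
  induction l generalizing i with
  | nil =>
    simp only [List.nil_append, IsPartialSum, List.sum_nil, Nat.zero_le, true_and, Nat.sub_zero]
    constructor
    · exact Or.inr
    · rintro (rfl | h)
      · exact zero _
      · exact h
  | cons a l ih =>
    simp only [List.cons_append, IsPartialSum, ih, List.sum_cons, Nat.sub_sub]
    constructor
    · rintro (h | ⟨h, h' | h'⟩)
      · simp [h]
      · simp [h, h']
      · exact Or.inr ⟨by omega, h'.2⟩
    · rintro ((h | h) | h)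
      · simp [h]
      · simp [h]
      · exact Or.inr ⟨by omega, Or.inr ⟨by omega, h.2⟩⟩

theorem reverse (l : List ℕ) (i : ℕ) : IsPartialSum l.reverse i ↔
    i ≤ l.sum ∧ IsPartialSum l (l.sum - i) := by
  induction l generalizing i with
  | nil => simp [IsPartialSum]
  | cons a l ih =>
    rw [List.reverse_cons, append, ih]
    simp only [List.sum_reverse, IsPartialSum, List.sum_cons]
    constructor
    · rintro (⟨h, h'⟩ | ⟨h, h' | h'⟩)
      · refine ⟨by omega, Or.inr ⟨by omega, ?_⟩⟩
        rwa [show a + l.sum - i - a = l.sum - i by omega]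
      · obtain rfl : i = l.sum := by omega
        refine ⟨by omega, Or.inr ⟨by omega, ?_⟩⟩
        rw [show a + l.sum - l.sum - a = 0 by omega]
        exact zero _
      · exact ⟨by omega, Or.inl (by omega)⟩
    · rintro ⟨h, h' | ⟨h', h''⟩⟩
      · exact Or.inr ⟨by omega, Or.inr ⟨by omega, by omega⟩⟩
      · refine Or.inl ⟨by omega, ?_⟩
        rwa [show a + l.sum - i - a = l.sum - i by omega] at h''

/-- With positive entries the head is the least positive partial sum, so it is recovered first; the
tails are compared after a shift. -/
theorem list_ext {l l' : List ℕ} (hl : ∀ a ∈ l, 0 < a) (hl' : ∀ a ∈ l', 0 < a)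
    (h : ∀ i, IsPartialSum l i ↔ IsPartialSum l' i) : l = l' := by
  induction l generalizing l' with
  | nil =>
    cases l' with
    | nil => rfl
    | cons b l' =>
      have h1 := le_sum ((h _).2 (sum (b :: l')))
      have := hl' b (by simp)
      simp at h1
      omega
  | cons a l ih =>
    cases l' with
    | nil =>
      have h1 := le_sum ((h _).1 (sum (a :: l)))
      have := hl a (by simp)
      simp at h1
      omega
    | cons b l' =>
      have ha := hl a (by simp)
      have hb := hl' b (by simp)
      have h1 := (h a).1 (Or.inr ⟨le_rfl, by simpa using zero l⟩)
      have h2 := (h b).2 (Or.inr ⟨le_rfl, by simpa using zero l'⟩)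
      simp only [IsPartialSum] at h1 h2
      obtain rfl : a = b := by omega
      congr 1
      refine ih (fun x hx => hl x (by simp [hx])) (fun x hx => hl' x (by simp [hx])) fun i => ?_
      have h3 := h (i + a)
      simpa [IsPartialSum, ha.ne'] using h3

/-- Any set of interior points can be prescribed. In the induction `p` is shifted by one; then a new
component 1 is put in front if 1 is to be a partial sum, and otherwise the head is increased by 1.
-/
theorem exists_list (n : ℕ) (p : ℕ → Prop) : ∃ l : List ℕ, l ≠ [] ∧ (∀ a ∈ l, 0 < a) ∧
    l.sum = n + 1 ∧ ∀ i, 0 < i → i < n + 1 → (IsPartialSum l i ↔ p i) := by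
  induction n generalizing p with
  | zero => exact ⟨[1], by simp, by simp, by simp, fun i _ _ => by omega⟩
  | succ n ih =>
    obtain ⟨l, hl, hpos, hsum, hp⟩ := ih fun i => p (i + 1)
    obtain ⟨a, l, rfl⟩ := List.exists_cons_of_ne_nil hl
    by_cases h1 : p 1
    · refine ⟨1 :: a :: l, by simp, by simpa using hpos, by simp at hsum ⊢; omega, ?_⟩
      intro i hi hi'
      obtain ⟨i, rfl⟩ : ∃ j, i = j + 1 := ⟨i - 1, by omega⟩
      rcases Nat.eq_zero_or_pos i with rfl | h
      · exact iff_of_true (Or.inr ⟨le_rfl, zero _⟩) h1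
      · rw [← hp i h (by omega)]
        conv_lhs => rw [IsPartialSum]
        simp
    · have ha := hpos a (by simp)
      refine ⟨(a + 1) :: l, by simp, ?_, by simp at hsum ⊢; omega, ?_⟩
      · intro x hx
        rcases List.mem_cons.1 hx with rfl | hx
        · omega
        · exact hpos x (by simp [hx])
      intro i hi hi'
      obtain ⟨i, rfl⟩ : ∃ j, i = j + 1 := ⟨i - 1, by omega⟩
      rcases Nat.eq_zero_or_pos i with rfl | h
      · simp only [zero_add, h1, iff_false, IsPartialSum]
        omega
      · rw [← hp i h (by omega)]
        simp [IsPartialSum, h.ne']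

theorem singleton (a i : ℕ) : IsPartialSum [a] i ↔ i = 0 ∨ i = a := by
  simp only [IsPartialSum]
  omega

theorem of_forall_eq_one {l : List ℕ} (hl : ∀ a ∈ l, a = 1) {i : ℕ} (h : i ≤ l.sum) :
    IsPartialSum l i := by
  induction l generalizing i with
  | nil => simpa [IsPartialSum] using h
  | cons a l ih =>
    obtain rfl := hl a (by simp)
    simp only [List.sum_cons] at h
    rcases Nat.eq_zero_or_pos i with rfl | h'
    · exact zero _
    · exact Or.inr ⟨h', ih (fun x hx => hl x (by simp [hx])) (by omega)⟩

/-- Adding two adjacent components deletes exactly the partial sum at their junction. -/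
theorem merge (l m : List ℕ) {a b : ℕ} (ha : 0 < a) (hb : 0 < b) (i : ℕ) :
    IsPartialSum (l ++ (a + b) :: m) i ↔ (IsPartialSum (l ++ [a]) i ∧ i ≠ l.sum + a) ∨
      (l.sum + a < i ∧ IsPartialSum (b :: m) (i - (l.sum + a))) := by
  simp only [append, IsPartialSum]
  rw [show i - (l.sum + a) - b = i - l.sum - (a + b) by omega]
  have := @le_sum l i
  constructor
  · rintro (h | ⟨h, h' | h'⟩)
    · exact Or.inl ⟨Or.inl h, by have := this h; omega⟩
    · exact Or.inl ⟨Or.inr ⟨h, Or.inl h'⟩, by omega⟩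
    · exact Or.inr ⟨by omega, Or.inr ⟨by omega, h'.2⟩⟩
  · rintro (⟨h | h, h'⟩ | ⟨h, h' | h'⟩)
    · exact Or.inl h
    · exact Or.inr ⟨h.1, Or.inl (by omega)⟩
    · omega
    · exact Or.inr ⟨by omega, Or.inr ⟨by omega, h'.2⟩⟩

end IsPartialSum

/-! ### Partial sums of near powers and of compositions -/

namespace Compn

theorem nearConcat_isPartialSum (α β : Compn) (i : ℕ) :
    IsPartialSum (α.nearConcat β).parts i ↔ (IsPartialSum α.parts i ∧ i ≠ α.size) ∨
      (α.size < i ∧ IsPartialSum β.parts (i - α.size)) := by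
  have h1 := List.dropLast_append_getLast α.ne_nil
  have h2 := List.cons_head_tail β.ne_nil
  have h3 := congrArg List.sum h1
  simp only [List.sum_append, List.sum_singleton] at h3
  have := IsPartialSum.merge α.parts.dropLast β.parts.tail
    (α.pos _ (List.getLast_mem α.ne_nil)) (β.pos _ (List.head_mem β.ne_nil)) i
  rw [h1, h2, h3] at this
  exact this

theorem size_nearConcat (α β : Compn) : (α.nearConcat β).size = α.size + β.size := by
  have h1 := congrArg List.sum (List.dropLast_append_getLast α.ne_nil)
  have h2 := congrArg List.sum (List.cons_head_tail β.ne_nil)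
  simp only [List.sum_append, List.sum_cons, List.sum_nil] at h1 h2
  simp only [nearConcat, size, List.sum_append, List.sum_cons]
  omega

theorem nearPow_succ_succ (β : Compn) (k : ℕ) :
    β.nearPow (k + 2) = (β.nearPow (k + 1)).nearConcat β := by
  simp [nearPow, Function.iterate_succ_apply']

theorem size_nearPow (β : Compn) (k : ℕ) : (β.nearPow (k + 1)).size = (k + 1) * β.size := by
  induction k with
  | zero => simp [nearPow]
  | succ k ih => rw [nearPow_succ_succ, size_nearConcat, ih]; ring

/-- Every junction is deleted, so no interior multiple of the size of `β` survives, while the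
pattern of `β` repeats in between. -/
theorem nearPow_isPartialSum (β : Compn) (k i : ℕ) :
    IsPartialSum (β.nearPow (k + 1)).parts i ↔ i = 0 ∨ i = (k + 1) * β.size ∨
      (i < (k + 1) * β.size ∧ ¬ β.size ∣ i ∧ IsPartialSum β.parts (i % β.size)) := by
  have hβ := β.one_le_size
  induction k generalizing i with
  | zero =>
    simp only [nearPow, Nat.zero_add, Nat.sub_self, Function.iterate_zero, id, one_mul]
    rcases lt_trichotomy i β.size with h | h | h
    · rw [Nat.mod_eq_of_lt h]
      constructor
      · intro h'
        by_cases h0 : i = 0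
        · exact Or.inl h0
        · exact Or.inr (Or.inr ⟨h, Nat.not_dvd_of_pos_of_lt (by omega) h, h'⟩)
      · rintro (rfl | h' | h')
        · exact .zero _
        · omega
        · exact h'.2.2
    · subst h
      exact iff_of_true (.sum _) (Or.inr (Or.inl rfl))
    · constructor
      · intro h'
        have : i ≤ β.size := h'.le_sum
        omega
      · omega
  | succ k ih =>
    have ih' := ih i
    rw [nearPow_succ_succ, nearConcat_isPartialSum, propext ih', size_nearPow]
    have e : (k + 1 + 1) * β.size = (k + 1) * β.size + β.size := by ring
    rw [e]
    have hpos : 0 < (k + 1) * β.size := by positivity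
    have hdvd : β.size ∣ (k + 1) * β.size := Dvd.intro_left _ rfl
    generalize (k + 1) * β.size = m at *
    rcases lt_or_ge m i with h | h
    · obtain ⟨j, rfl⟩ := Nat.exists_eq_add_of_lt h
      have e1 : m + j + 1 - m = j + 1 := by omega
      rw [e1, show m + j + 1 = j + 1 + m by ring, Nat.dvd_add_left hdvd]
      have e2 : (j + 1 + m) % β.size = (j + 1) % β.size := by
        obtain ⟨c, rfl⟩ := hdvd
        simp
      rw [e2]
      constructor
      · rintro (h' | h')
        · omega
        · have h1 : j + 1 ≤ β.size := h'.2.le_sum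
          rcases h1.eq_or_lt with h1 | h1
          · exact Or.inr (Or.inl (by omega))
          · exact Or.inr (Or.inr ⟨by omega, Nat.not_dvd_of_pos_of_lt (by omega) h1,
              by rw [Nat.mod_eq_of_lt h1]; exact h'.2⟩)
      · rintro (h' | h' | ⟨h', -, h''⟩)
        · omega
        · refine Or.inr ⟨by omega, ?_⟩
          rw [show j + 1 = β.parts.sum from (by omega : j + 1 = β.size)]
          exact .sum _
        · rw [Nat.mod_eq_of_lt (by omega)] at h''
          exact Or.inr ⟨by omega, h''⟩
    · constructor
      · rintro (⟨h1 | h1 | h1, h'⟩ | h')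
        · exact Or.inl h1
        · exact absurd h1 h'
        · exact Or.inr (Or.inr ⟨by omega, h1.2⟩)
        · omega
      · rintro (h' | h' | ⟨h', h1, h2⟩)
        · exact Or.inl ⟨Or.inl h', by omega⟩
        · omega
        · have : i ≠ m := by rintro rfl; exact h1 hdvd
          exact Or.inl ⟨Or.inr (Or.inr ⟨by omega, h1, h2⟩), this⟩

theorem sum_flatMap_nearPow (β : Compn) (l : List ℕ) (hl : ∀ a ∈ l, 0 < a) :
    (l.flatMap fun a => (β.nearPow a).parts).sum = l.sum * β.size := by
  induction l with
  | nil => simp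
  | cons a l ih =>
    have ha := hl a (by simp)
    obtain ⟨k, rfl⟩ : ∃ k, a = k + 1 := ⟨a - 1, by omega⟩
    have := size_nearPow β k
    rw [size] at this
    rw [List.flatMap_cons, List.sum_append, ih fun x hx => hl x (by simp [hx]), this,
      List.sum_cons]
    ring

theorem size_comp (α β : Compn) : (comp α β).size = α.size * β.size :=
  sum_flatMap_nearPow β _ α.pos

theorem flatMap_nearPow_isPartialSum (β : Compn) (l : List ℕ) (hl : ∀ a ∈ l, 0 < a) (i : ℕ) :
    IsPartialSum (l.flatMap fun a => (β.nearPow a).parts) i ↔ i ≤ l.sum * β.size ∧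
      if β.size ∣ i then IsPartialSum l (i / β.size) else IsPartialSum β.parts (i % β.size) := by
  have hβ := β.one_le_size
  induction l generalizing i with
  | nil =>
    simp only [List.flatMap_nil, IsPartialSum, List.sum_nil, zero_mul, Nat.le_zero]
    constructor
    · rintro rfl
      simp
    · exact fun h => h.1
  | cons a l ih =>
    have ha := hl a (by simp)
    obtain ⟨k, rfl⟩ : ∃ k, a = k + 1 := ⟨a - 1, by omega⟩
    have hs : (β.nearPow (k + 1)).parts.sum = _ := size_nearPow β k
    rw [List.flatMap_cons, IsPartialSum.append, nearPow_isPartialSum, hs]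
    have ih' := ih (fun x hx => hl x (by simp [hx])) (i - (k + 1) * β.size)
    rw [propext ih']
    simp only [IsPartialSum, List.sum_cons, add_mul _ _ β.size]
    rw [← add_mul]
    by_cases hd : β.size ∣ i
    · obtain ⟨c, rfl⟩ := hd
      simp only [not_true, false_and, and_false, or_false, if_true,
        mul_comm β.size, ← Nat.sub_mul, Nat.mul_div_cancel _ hβ,
        Nat.mul_le_mul_right_iff hβ, ← add_mul, Nat.mul_left_inj (Nat.one_le_iff_ne_zero.1 hβ), mul_eq_zero,
        (Nat.one_le_iff_ne_zero.1 hβ), dvd_mul_left]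
      constructor
      · rintro ((rfl | rfl) | h)
        · simp
        · exact ⟨by omega, Or.inr ⟨le_rfl, by simpa using .zero _⟩⟩
        · exact ⟨by omega, Or.inr ⟨h.1, h.2.2⟩⟩
      · rintro ⟨h, h' | h'⟩
        · simp [h']
        · exact Or.inr ⟨h'.1, by omega, h'.2⟩
    · have h1 : i ≠ 0 := by rintro rfl; simp at hd
      have h2 : i ≠ (k + 1) * β.size := by rintro rfl; simp at hd
      simp only [h1, h2, hd, false_or, not_false_iff, true_and, if_false]
      generalize hm : (k + 1) * β.size = m at *
      have hm' : β.size ∣ m := ⟨k + 1, by rw [← hm]; ring⟩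
      rcases lt_or_ge i m with h | h
      · simp only [h, true_and, not_le.2 h, false_and, or_false]
        exact ⟨fun h' => ⟨by omega, h'⟩, fun h' => h'.2⟩
      · obtain ⟨j, rfl⟩ := Nat.exists_eq_add_of_le h
        have hj : ¬ β.size ∣ j := fun h' => hd (dvd_add hm' h')
        obtain ⟨c, rfl⟩ := hm'
        simp only [Nat.add_sub_cancel_left, hj, if_false, Nat.mul_add_mod]
        constructor
        · rintro (h' | h')
          · omega
          · exact ⟨by omega, h'.2.2⟩
        · rintro h'
          exact Or.inr ⟨by omega, by omega, h'.2⟩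

/-! ### Periodic cuts -/

/-- `i` is, modulo the size of `α`, a partial sum of `α`. -/
def IsCut (α : Compn) (i : ℕ) : Prop := IsPartialSum α.parts (i % α.size)

theorem isCut_congr (α : Compn) {i j : ℕ} (h : i ≡ j [MOD α.size]) : α.IsCut i ↔ α.IsCut j := by
  rw [IsCut, IsCut, h]

theorem isCut_of_dvd (α : Compn) {i : ℕ} (h : α.size ∣ i) : α.IsCut i := by
  rw [IsCut, Nat.mod_eq_zero_of_dvd h]
  exact .zero _

theorem isPartialSum_iff_isCut (α : Compn) (i : ℕ) :
    IsPartialSum α.parts i ↔ i ≤ α.size ∧ α.IsCut i := by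
  constructor
  · intro h
    have h' : i ≤ α.size := h.le_sum
    refine ⟨h', ?_⟩
    rcases h'.eq_or_lt with rfl | h'
    · exact α.isCut_of_dvd dvd_rfl
    · rwa [IsCut, Nat.mod_eq_of_lt h']
  · rintro ⟨h, h'⟩
    rcases h.eq_or_lt with rfl | h
    · exact .sum _
    · rwa [IsCut, Nat.mod_eq_of_lt h] at h'

/-- Multiples of the size are always cuts and carry no information, so only the others need
comparison. -/
theorem ext_isCut {α β : Compn} (h : α.size = β.size)
    (h' : ∀ i, ¬ α.size ∣ i → (α.IsCut i ↔ β.IsCut i)) : α = β := by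
  refine Compn.ext (IsPartialSum.list_ext α.pos β.pos fun i => ?_)
  rw [isPartialSum_iff_isCut, isPartialSum_iff_isCut, h]
  by_cases hi : α.size ∣ i
  · simp [α.isCut_of_dvd hi, β.isCut_of_dvd (h ▸ hi)]
  · rw [h' i hi]

theorem exists_isCut_iff {n : ℕ} (hn : 1 ≤ n) (p : ℕ → Prop) :
    ∃ α : Compn, α.size = n ∧ ∀ i, ¬ n ∣ i → (α.IsCut i ↔ p (i % n)) := by
  obtain ⟨l, h1, h2, h3, h4⟩ := IsPartialSum.exists_list (n - 1) p
  rw [Nat.sub_add_cancel hn] at h3 h4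
  refine ⟨⟨l, h1, h2⟩, h3, fun i hi => ?_⟩
  rw [← h4 _ (Nat.pos_of_ne_zero fun h => hi (Nat.dvd_of_mod_eq_zero h)) (Nat.mod_lt _ hn), IsCut,
    show size ⟨l, h1, h2⟩ = n from h3]

theorem isCut_comp (α β : Compn) (i : ℕ) : (comp α β).IsCut i ↔
    if β.size ∣ i then α.IsCut (i / β.size) else β.IsCut i := by
  have hlt : i % (α.size * β.size) ≤ α.size * β.size :=
    (Nat.mod_lt _ (Nat.mul_pos α.one_le_size β.one_le_size)).le
  -- At a residue modulo the total size the range condition holds automatically, so only the case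
  -- distinction remains.
  have h := flatMap_nearPow_isPartialSum β α.parts α.pos (i % (α.size * β.size))
  rw [IsCut, size_comp]
  refine h.trans ?_
  simp only [Nat.dvd_mod_iff (Dvd.intro_left _ rfl), Nat.mod_mod_of_dvd _ (Dvd.intro_left _ rfl),
    Nat.mod_mul_left_div_self]
  refine (and_iff_right hlt).trans ?_
  simp only [IsCut]

theorem isCut_comp_mul (α β : Compn) (i : ℕ) :
    (comp α β).IsCut (β.size * i) ↔ α.IsCut i := by
  rw [isCut_comp, if_pos (dvd_mul_right _ _), Nat.mul_div_cancel_left _ β.one_le_size]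

theorem isCut_comp_of_not_dvd (α β : Compn) {i : ℕ} (h : ¬ β.size ∣ i) :
    (comp α β).IsCut i ↔ β.IsCut i := by
  rw [isCut_comp, if_neg h]

theorem size_reversal (α : Compn) : α.reversal.size = α.size := by
  simp [reversal, size]

/-- Reversal is negation modulo the size; the divisibility hypothesis expresses j ≡ -i without
truncated subtraction. -/
theorem isCut_reversal (α : Compn) {i j : ℕ} (h : α.size ∣ i + j) :
    α.reversal.IsCut i ↔ α.IsCut j := by
  by_cases hi : α.size ∣ i
  · have hj : α.size ∣ j := (Nat.dvd_add_right hi).1 h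
    simp [α.isCut_of_dvd hj, α.reversal.isCut_of_dvd (α.size_reversal ▸ hi)]
  · rw [IsCut, size_reversal]
    have hlt := Nat.mod_lt i α.one_le_size
    refine (IsPartialSum.reverse α.parts _).trans ?_
    have e : α.parts.sum = α.size := rfl
    rw [e, and_iff_right hlt.le]
    have hpos : i % α.size ≠ 0 := fun h => hi (Nat.dvd_of_mod_eq_zero h)
    have h' : j % α.size = α.size - i % α.size := by
      have h1 : α.size ∣ i % α.size + j % α.size := by
        rw [Nat.dvd_iff_mod_eq_zero, ← Nat.add_mod]
        exact Nat.mod_eq_zero_of_dvd h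
      have hlt' := Nat.mod_lt j α.one_le_size
      obtain ⟨c, hc⟩ := h1
      have : c = 1 := by
        have : c < 2 := by
          by_contra hc2
          have : α.size * 2 ≤ α.size * c := Nat.mul_le_mul_left _ (by omega)
          omega
        have : c ≠ 0 := by
          rintro rfl
          omega
        omega
      subst this
      omega
    rw [IsCut, h']

/-! ### Algebra of composition -/

theorem eq_one_iff (α : Compn) : α = one ↔ α.size = 1 := by
  constructor
  · rintro rfl
    rfl
  · intro h
    exact ext_isCut h fun i hi => absurd (h ▸ one_dvd i) hi

theorem comp_one (α : Compn) : comp α one = α := by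
  refine ext_isCut (by simp [size_comp, (eq_one_iff one).1 rfl]) fun i _ => ?_
  simp [isCut_comp, (eq_one_iff one).1 rfl]

theorem one_comp (α : Compn) : comp one α = α := by
  refine ext_isCut (by simp [size_comp, (eq_one_iff one).1 rfl]) fun i hi => ?_
  rw [size_comp, (eq_one_iff one).1 rfl, one_mul] at hi
  rw [isCut_comp_of_not_dvd _ _ hi]

theorem comp_assoc (α β γ : Compn) : comp (comp α β) γ = comp α (comp β γ) := by
  refine ext_isCut (by simp [size_comp, mul_assoc]) fun i _ => ?_
  have hβ := β.one_le_size
  have hγ := γ.one_le_size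
  by_cases h : γ.size ∣ i
  · obtain ⟨j, rfl⟩ := h
    rw [isCut_comp_mul]
    by_cases h : β.size ∣ j
    · obtain ⟨k, rfl⟩ := h
      rw [isCut_comp_mul, ← mul_assoc, mul_comm γ.size, ← size_comp, isCut_comp_mul]
    · rw [isCut_comp_of_not_dvd _ _ h, isCut_comp_of_not_dvd, isCut_comp_mul]
      rwa [size_comp, mul_comm β.size, Nat.mul_dvd_mul_iff_left hγ]
  · rw [isCut_comp_of_not_dvd _ _ h, isCut_comp_of_not_dvd, isCut_comp_of_not_dvd _ _ h]
    rw [size_comp]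
    exact fun h' => h (dvd_of_mul_left_dvd h')

theorem reversal_comp (α β : Compn) : (comp α β).reversal = comp α.reversal β.reversal := by
  refine ext_isCut (by simp [size_comp, size_reversal]) fun i _ => ?_
  have hN := size_comp α β
  obtain ⟨j, hj⟩ : ∃ j, (comp α β).size ∣ i + j := by
    -- With N the total size, (N - 1)i represents -i modulo N.
    refine ⟨((comp α β).size - 1) * i, i, ?_⟩
    have := (comp α β).one_le_size
    obtain ⟨c, hc⟩ := Nat.exists_eq_add_of_le this
    rw [hc]
    simp
    ring
  have hβ : β.size ∣ i + j := (hN ▸ Dvd.intro_left _ rfl).trans hj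
  rw [isCut_reversal _ hj]
  by_cases h : β.size ∣ i
  · have h' : β.size ∣ j := (Nat.dvd_add_right h).1 hβ
    obtain ⟨c, rfl⟩ := h
    obtain ⟨d, rfl⟩ := h'
    rw [isCut_comp_mul, ← size_reversal β, isCut_comp_mul, isCut_reversal]
    rwa [hN, ← mul_add, mul_comm α.size, Nat.mul_dvd_mul_iff_left β.one_le_size] at hj
  · have h' : ¬ β.size ∣ j := fun h' => h ((Nat.dvd_add_left h').1 hβ)
    rw [isCut_comp_of_not_dvd _ _ h', isCut_comp_of_not_dvd _ _ (by rwa [size_reversal]),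
      isCut_reversal _ hβ]

/-- Once the size of the right factor is known, the left factor is read off at its multiples and the
right factor off them. -/
theorem comp_inj_of_size_eq {α α' β β' : Compn} (h : comp α β = comp α' β')
    (hs : β.size = β'.size) : α = α' ∧ β = β' := by
  have hsz := congrArg size h
  rw [size_comp, size_comp, hs] at hsz
  constructor
  · refine ext_isCut (Nat.eq_of_mul_eq_mul_right β'.one_le_size hsz) fun i _ => ?_
    rw [← isCut_comp_mul α β, h, hs, isCut_comp_mul]
  · refine ext_isCut hs fun i hi => ?_
    rw [← isCut_comp_of_not_dvd α β hi, h, isCut_comp_of_not_dvd _ _ (hs ▸ hi)]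

/-! ### Sizes of right factors -/

/-- `α` has a right factor of size `n`, expressed in terms of its partial sums. -/
def IsRightSize (α : Compn) (n : ℕ) : Prop :=
  n ∣ α.size ∧ ∀ i j, ¬ n ∣ i → i ≡ j [MOD n] → (α.IsCut i ↔ α.IsCut j)

theorem isRightSize_comp (α β : Compn) : (comp α β).IsRightSize β.size := by
  refine ⟨size_comp α β ▸ Dvd.intro_left _ rfl, fun i j hi hij => ?_⟩
  have hj : ¬ β.size ∣ j := fun h => hi ((hij.dvd_iff dvd_rfl).2 h)
  rw [isCut_comp_of_not_dvd _ _ hi, isCut_comp_of_not_dvd _ _ hj, isCut_congr _ hij]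

namespace IsRightSize

variable {α : Compn} {n m : ℕ}

theorem pos (h : α.IsRightSize n) : 1 ≤ n :=
  Nat.pos_of_dvd_of_pos h.1 α.one_le_size

theorem exists_comp (h : α.IsRightSize n) : ∃ β γ : Compn, α = comp β γ ∧ γ.size = n := by
  have hn := h.pos
  obtain ⟨⟨k, hk⟩, h'⟩ := h
  have hk1 : 1 ≤ k := Nat.pos_of_ne_zero (by rintro rfl; have := α.one_le_size; omega)
  obtain ⟨γ, hγ, hγ'⟩ := exists_isCut_iff hn α.IsCut
  obtain ⟨β, hβ, hβ'⟩ := exists_isCut_iff hk1 fun i => α.IsCut (n * i)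
  have hs : α.size = (comp β γ).size := by rw [size_comp, hβ, hγ, hk, mul_comm]
  refine ⟨β, γ, ext_isCut hs fun i hi => ?_, hγ⟩
  by_cases hd : n ∣ i
  · obtain ⟨j, rfl⟩ := hd
    rw [hk, Nat.mul_dvd_mul_iff_left hn] at hi
    have := isCut_comp_mul β γ j
    rw [hγ] at this
    rw [this, hβ' _ hi]
    refine isCut_congr _ ?_
    rw [hk]
    exact (Nat.ModEq.mul_left' n (Nat.mod_modEq j k)).symm
  · rw [isCut_comp_of_not_dvd _ _ (by rwa [hγ]), hγ' _ hd]
    exact h' _ _ hd (Nat.mod_modEq _ _).symm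

/-- If i ≡ j modulo the gcd, some k is ≡ i mod n and ≡ j mod m; i is compared with k by periodicity
mod n, and k with j mod m. -/
theorem gcd (hn : α.IsRightSize n) (hm : α.IsRightSize m) : α.IsRightSize (n.gcd m) := by
  refine ⟨(Nat.gcd_dvd_left n m).trans hn.1, fun i j hi hij => ?_⟩
  obtain ⟨k, hk, hk'⟩ := Nat.chineseRemainder' hij
  have hki : ¬ m ∣ k := fun h => hi <|
    ((hk.of_dvd (Nat.gcd_dvd_left n m)).dvd_iff dvd_rfl).1 ((Nat.gcd_dvd_right n m).trans h)
  rw [hn.2 i k (fun h => hi ((Nat.gcd_dvd_left n m).trans h)) hk.symm, hm.2 k j hki hk']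

theorem lcm (hn : α.IsRightSize n) (hm : α.IsRightSize m) : α.IsRightSize (n.lcm m) := by
  refine ⟨Nat.lcm_dvd hn.1 hm.1, fun i j hi hij => ?_⟩
  by_cases h : n ∣ i
  · by_cases h' : m ∣ i
    · exact absurd (Nat.lcm_dvd h h') hi
    · exact hm.2 i j h' (hij.of_dvd (Nat.dvd_lcm_right n m))
  · exact hn.2 i j h (hij.of_dvd (Nat.dvd_lcm_left n m))

/-- When the lcm is the full size, a nontrivial multiple i of n is not a multiple of m. Some k ≡ i
mod m and k ≡ m mod n links its status to that of m. So the left factor belonging to n is constant.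
-/
theorem isCut_iff_of_lcm_eq (hn : α.IsRightSize n) (hm : α.IsRightSize m)
    (hlcm : n.lcm m = α.size) (h : ¬ n ∣ m) {i : ℕ} (hni : n ∣ i) (hi : ¬ α.size ∣ i) :
    α.IsCut i ↔ α.IsCut m := by
  have hmi : ¬ m ∣ i := fun h' => hi (hlcm ▸ Nat.lcm_dvd hni h')
  have hg : i ≡ m [MOD m.gcd n] :=
    ((Nat.modEq_zero_iff_dvd.2 ((Nat.gcd_dvd_right m n).trans hni))).trans
      (Nat.modEq_zero_iff_dvd.2 (Nat.gcd_dvd_left m n)).symm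
  obtain ⟨k, hk, hk'⟩ := Nat.chineseRemainder' hg
  rw [hm.2 i k hmi hk.symm, hn.2 k m (fun h' => h ((hk'.dvd_iff dvd_rfl).1 h')) hk']

end IsRightSize

/-! ### Constant and irreducible compositions -/

/-- All partial sums strictly between `0` and `|α|` occur (`b = true`), or none (`b = false`). -/
def IsConst (b : Bool) (α : Compn) : Prop := ∀ i, ¬ α.size ∣ i → (α.IsCut i ↔ b = true)

theorem isConst_of_eq_one (b : Bool) {α : Compn} (h : α = one) : α.IsConst b :=
  fun i hi => absurd ((α.eq_one_iff.1 h).symm ▸ one_dvd i) hi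

theorem IsConst.unique {b : Bool} {α β : Compn} (hα : α.IsConst b) (hβ : β.IsConst b)
    (h : α.size = β.size) : α = β :=
  ext_isCut h fun i hi => (hα i hi).trans (hβ i (h ▸ hi)).symm

theorem exists_isConst (b : Bool) {n : ℕ} (hn : 1 ≤ n) : ∃ α : Compn, α.size = n ∧ α.IsConst b := by
  obtain ⟨α, h, h'⟩ := exists_isCut_iff hn fun _ => b = true
  exact ⟨α, h, fun i hi => h' i (h ▸ hi)⟩

theorem IsConst.eq_one {α : Compn} (h : α.IsConst false) (h' : α.IsConst true) : α = one := by
  rw [eq_one_iff]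
  by_contra h1
  have hd : ¬ α.size ∣ 1 := by rwa [Nat.dvd_one]
  have := (h 1 hd).symm.trans (h' 1 hd)
  simp at this

theorem length_eq_one_iff (α : Compn) : α.length = 1 ↔ α.IsConst false := by
  have key : ∀ β : Compn, β.length = 1 → β.IsConst false := by
    intro β h i hi
    obtain ⟨a, ha⟩ := List.length_eq_one_iff.1 h
    have hs : β.size = a := by simp [size, ha]
    have := Nat.mod_lt i β.one_le_size
    have h0 : i % β.size ≠ 0 := fun h => hi (Nat.dvd_of_mod_eq_zero h)
    rw [IsCut, ha, IsPartialSum.singleton]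
    simp only [Bool.false_eq_true, iff_false]
    omega
  refine ⟨key α, fun h => ?_⟩
  have hβ : (⟨[α.size], by simp, by simpa using Nat.lt_of_succ_le α.one_le_size⟩ : Compn).length = 1 := rfl
  rw [h.unique (key _ hβ) (by simp [size])]
  rfl

theorem allOnes_iff (α : Compn) : α.AllOnes ↔ α.IsConst true := by
  have key : ∀ β : Compn, β.AllOnes → β.IsConst true := fun β h i _ =>
    iff_of_true (IsPartialSum.of_forall_eq_one h (Nat.mod_lt i β.one_le_size).le) rfl
  refine ⟨key α, fun h => ?_⟩
  have hα := α.one_le_size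
  have hβ : (⟨List.replicate α.size 1, by simp; omega, by simp⟩ : Compn).AllOnes :=
    fun a ha => (List.mem_replicate.1 ha).2
  rw [h.unique (key _ hβ) (by simp [size])]
  exact hβ

theorem isTrivialPair_iff (β γ : Compn) : IsTrivialPair β γ ↔
    β = one ∨ γ = one ∨ ∃ b, β.IsConst b ∧ γ.IsConst b := by
  simp [IsTrivialPair, length_eq_one_iff, allOnes_iff, or_assoc]

theorem isIrreducible_iff (α : Compn) :
    α.IsIrreducible ↔ (∀ b, ¬ α.IsConst b) ∧ α.OnlyTrivialFactorisations := by
  simp [IsIrreducible, length_eq_one_iff, allOnes_iff, and_assoc]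

theorem IsIrreducible.ne_one {α : Compn} (h : α.IsIrreducible) : α ≠ one :=
  fun h' => (α.isIrreducible_iff.1 h).1 true (isConst_of_eq_one _ h')

theorem isConst_comp_iff (b : Bool) (α β : Compn) :
    (comp α β).IsConst b ↔ α.IsConst b ∧ β.IsConst b := by
  have hβ := β.one_le_size
  have hs := size_comp α β
  constructor
  · intro h
    refine ⟨fun i hi => ?_, fun i hi => ?_⟩
    · rw [← isCut_comp_mul α β]
      refine h _ ?_
      rwa [hs, mul_comm, Nat.mul_dvd_mul_iff_left hβ]
    · rw [← isCut_comp_of_not_dvd α β hi]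
      exact h _ fun h' => hi ((Dvd.intro_left _ hs.symm).trans h')
  · rintro ⟨h, h'⟩ i hi
    by_cases hd : β.size ∣ i
    · obtain ⟨j, rfl⟩ := hd
      rw [isCut_comp_mul]
      refine h _ fun hj => hi ?_
      rwa [hs, mul_comm, Nat.mul_dvd_mul_iff_left hβ]
    · rw [isCut_comp_of_not_dvd _ _ hd, h' _ hd]

theorem IsConst.onlyTrivialFactorisations {b : Bool} {α : Compn} (h : α.IsConst b) :
    α.OnlyTrivialFactorisations := by
  rintro β γ rfl
  exact (isTrivialPair_iff _ _).2 (Or.inr (Or.inr ⟨b, (isConst_comp_iff b β γ).1 h⟩))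

theorem OnlyTrivialFactorisations.isIrreducible_or {α : Compn} (h : α.OnlyTrivialFactorisations) :
    α.IsIrreducible ∨ ∃ b, α.IsConst b := by
  rw [isIrreducible_iff]
  by_cases h' : ∃ b, α.IsConst b
  · exact Or.inr h'
  · exact Or.inl ⟨not_exists.1 h', h⟩

/-! ### Cancellation of irreducible left factors -/

/-- If `α ∘ β = α' ∘ β'` and the size of `β` divides that of `β'`, then `β'` has the right factor `β`
and `α` has the left factor `α'`. -/
theorem exists_comp_of_dvd {α β α' β' : Compn} (h : comp α β = comp α' β')
    (hd : β.size ∣ β'.size) : ∃ δ, α = comp α' δ ∧ β' = comp δ β := by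
  obtain ⟨k, hk⟩ := hd
  have hr : β'.IsRightSize β.size := by
    refine ⟨Dvd.intro _ hk.symm, fun i j hi hij => ?_⟩
    have aux : ∀ i, ¬ β.size ∣ i → ¬ β'.size ∣ i := fun i hi h => hi ((Dvd.intro _ hk.symm).trans h)
    have hj : ¬ β.size ∣ j := fun h => hi ((hij.dvd_iff dvd_rfl).2 h)
    rw [← isCut_comp_of_not_dvd α' β' (aux i hi), ← isCut_comp_of_not_dvd α' β' (aux j hj), ← h]
    exact (isRightSize_comp α β).2 i j hi hij
  obtain ⟨δ, ε, rfl, hε⟩ := hr.exists_comp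
  rw [← comp_assoc] at h
  obtain ⟨h1, rfl⟩ := comp_inj_of_size_eq h hε.symm
  exact ⟨δ, h1, rfl⟩

theorem comp_ne_one_left {α β : Compn} (h : α ≠ one) : comp α β ≠ one := by
  rw [Ne, eq_one_iff] at *
  rw [size_comp]
  intro h'
  exact h (Nat.dvd_one.1 (Dvd.intro _ h'))

/-- Left cancellation for an irreducible left factor. -/
theorem IsIrreducible.comp_inj {π f β β' : Compn} (hπ : π.IsIrreducible)
    (hf : f.OnlyTrivialFactorisations) (hf1 : f ≠ one) (h : comp π β = comp f β') :
    π = f ∧ β = β' := by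
  have hπ' := (isIrreducible_iff _).1 hπ
  -- A trivial factorisation with both factors different from (1) consists of constants of one kind,
  -- which would make π constant.
  have hnot : ∀ δ, δ ≠ one → ∀ γ, γ ≠ one → π ≠ comp γ δ := by
    intro δ hδ γ hγ e
    rcases (isTrivialPair_iff _ _).1 (hπ'.2 _ _ e) with h | h | ⟨b, h⟩
    · exact hγ h
    · exact hδ h
    · exact hπ'.1 b (e ▸ (isConst_comp_iff _ _ _).2 h)
  have hD := isRightSize_comp π β
  have hD' := h ▸ isRightSize_comp f β'
  by_cases h1 : β.size = β'.size
  · exact comp_inj_of_size_eq h h1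
  exfalso
  by_cases h2 : β.size ∣ β'.size
  · obtain ⟨δ, e, rfl⟩ := exists_comp_of_dvd h h2
    refine hnot δ (fun hδ => h1 ?_) f hf1 e
    rw [hδ, one_comp]
  by_cases hlcm : β.size.lcm β'.size = (comp π β).size
  -- If the lcm is the full size, all nontrivial multiples of |β| share the status of |β'|, so π
  -- would be constant.
  · classical
    refine hπ'.1 (decide ((comp π β).IsCut β'.size)) fun i hi => ?_
    rw [decide_eq_true_iff, ← hD.isCut_iff_of_lcm_eq hD' hlcm h2 (dvd_mul_right _ i),
      isCut_comp_mul]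
    rwa [size_comp, mul_comm, Nat.mul_dvd_mul_iff_left β.one_le_size]
  -- Here the right factor ε of size lcm is proper, so π = γ ∘ δ with γ ≠ (1). This forces δ = (1),
  -- hence |β'| divides |β| and π is a left factor of f.
  · obtain ⟨γ, ε, e, hε⟩ := (hD.lcm hD').exists_comp
    obtain ⟨δ, e1, rfl⟩ := exists_comp_of_dvd e (hε ▸ Nat.dvd_lcm_left _ _)
    by_cases hδ : δ = one
    · subst hδ
      rw [one_comp] at hε
      have h3 : β'.size ∣ β.size := hε ▸ Nat.dvd_lcm_right _ _
      obtain ⟨κ, e2, rfl⟩ := exists_comp_of_dvd h.symm h3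
      rcases (isTrivialPair_iff _ _).1 (hf _ _ e2) with h | h | ⟨b, h⟩
      · exact hπ.ne_one h
      · subst h
        simp [one_comp] at h1
      · exact hπ'.1 b h.1
    · refine hnot δ hδ γ (fun hγ => hlcm ?_) e1
      rw [← hε, e, hγ, one_comp]

/-! ### Constant left factors -/

/-- `α = κ ∘ β` for a composition `κ ≠ (1)` with all components `1` or with length `1`,
depending on `b`. -/
def HasConstLeft (b : Bool) (α : Compn) : Prop :=
  ∃ κ β, κ ≠ one ∧ κ.IsConst b ∧ α = comp κ β

theorem not_hasConstLeft_one (b : Bool) : ¬ one.HasConstLeft b := by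
  rintro ⟨κ, β, h, -, e⟩
  exact comp_ne_one_left h e.symm

/-- Nontrivial multiples of |β| have status `b`, those of |β'| status `b'`. If the lcm of these
sizes is proper, it is a multiple of both. If it is the full size, `isCut_iff_of_lcm_eq` equates the
status of |β| with that of |β'|. -/
theorem HasConstLeft.unique {b b' : Bool} {α : Compn} (h : α.HasConstLeft b)
    (h' : α.HasConstLeft b') : b = b' := by
  obtain ⟨κ, β, h1, h2, rfl⟩ := h
  obtain ⟨κ', β', h1', h2', e⟩ := h'
  have hD := isRightSize_comp κ β
  have hD' := e ▸ isRightSize_comp κ' β'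
  have aux : ∀ {b : Bool} {κ β : Compn}, κ.IsConst b → ∀ {i}, β.size ∣ i →
      ¬ (comp κ β).size ∣ i → ((comp κ β).IsCut i ↔ b = true) := by
    rintro b κ β h _ ⟨i, rfl⟩ hi
    rw [isCut_comp_mul, h]
    rwa [size_comp, mul_comm, Nat.mul_dvd_mul_iff_left β.one_le_size] at hi
  have aux2 : ∀ {κ β : Compn}, κ ≠ one → ¬ (comp κ β).size ∣ β.size := by
    intro κ β h hd
    rw [size_comp] at hd
    have hβ := β.one_le_size
    have := Nat.le_of_dvd hβ hd
    have h1 := κ.one_le_size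
    rw [Ne, eq_one_iff] at h
    have : 2 * β.size ≤ κ.size * β.size := Nat.mul_le_mul_right _ (by omega)
    omega
  have hβ' := aux2 (β := β') h1'
  rw [← e] at hβ'
  have key : ∀ {i}, β'.size ∣ i → ¬ (comp κ β).size ∣ i → ((comp κ β).IsCut i ↔ b' = true) := by
    rw [e]
    exact aux h2'
  rw [Bool.eq_iff_iff]
  by_cases hlcm : β.size.lcm β'.size = (comp κ β).size
  · rw [← key dvd_rfl hβ', ← aux h2 dvd_rfl (aux2 h1)]
    exact hD.isCut_iff_of_lcm_eq hD' hlcm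
      (fun h => hβ' (by rw [← hlcm, Nat.lcm_eq_right h])) dvd_rfl (aux2 h1)
  · have hl : ¬ (comp κ β).size ∣ β.size.lcm β'.size := fun h =>
      hlcm (Nat.dvd_antisymm (hD.lcm hD').1 h)
    rw [← key (Nat.dvd_lcm_right _ _) hl, ← aux h2 (Nat.dvd_lcm_left _ _) hl]

theorem IsIrreducible.not_hasConstLeft {π β : Compn} (h : π.IsIrreducible) (b : Bool) :
    ¬ (comp π β).HasConstLeft b := by
  rintro ⟨κ, γ, h1, h2, e⟩
  obtain ⟨rfl, -⟩ := h.comp_inj h2.onlyTrivialFactorisations h1 e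
  exact ((isIrreducible_iff _).1 h).1 b h2

/-- A factorisation with constant left factor refines one whose left factor is maximal. -/
theorem exists_comp_of_not_hasConstLeft {b : Bool} {κ β κ' β' : Compn} (hκ : κ.IsConst b)
    (hκ' : κ'.IsConst b) (hβ' : ¬ β'.HasConstLeft b) (h : comp κ β = comp κ' β') :
    ∃ δ, δ.IsConst b ∧ β = comp δ β' := by
  have hD := isRightSize_comp κ β
  have hD' := h ▸ isRightSize_comp κ' β'
  -- Both factorisations are refined by the right factor ε of size gcd. The complementary left
  -- factor γ is shown to be constant as well; maximality of β' then gives ε = β'.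
  obtain ⟨γ, ε, e, hε⟩ := (hD.gcd hD').exists_comp
  have hγ : γ.IsConst b := by
    intro i hi
    rw [← isCut_comp_mul γ ε, ← e]
    have hi' : ¬ (comp κ β).size ∣ ε.size * i := by
      rwa [e, size_comp, mul_comm, Nat.mul_dvd_mul_iff_left ε.one_le_size]
    by_cases hd : β.size ∣ ε.size * i
    · obtain ⟨j, hj⟩ := hd
      rw [hj] at hi' ⊢
      rw [isCut_comp_mul, hκ]
      rwa [size_comp, mul_comm, Nat.mul_dvd_mul_iff_left β.one_le_size] at hi'
    -- A point off the multiples of |β| may be moved by multiples of |β|, and by the Chinese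
    -- remainder theorem it can reach a multiple of |β'|, where κ' decides.
    · have hg : ε.size * i ≡ 0 [MOD β.size.gcd β'.size] := by
        rw [Nat.modEq_zero_iff_dvd, ← hε]
        exact dvd_mul_right _ _
      obtain ⟨k, hk, hk'⟩ := Nat.chineseRemainder' hg
      obtain ⟨j, rfl⟩ := Nat.modEq_zero_iff_dvd.1 hk'
      have hd' : ¬ β.size ∣ β'.size * j := fun h' => hd ((hk.dvd_iff dvd_rfl).1 h')
      have hd2 : ¬ (comp κ β).size ∣ β'.size * j := fun h' =>
        hd' ((Dvd.intro_left _ (size_comp _ _).symm).trans h')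
      rw [hD.2 _ _ hd hk.symm]
      rw [h] at hd2 ⊢
      rw [isCut_comp_mul, hκ']
      rwa [size_comp, mul_comm, Nat.mul_dvd_mul_iff_left β'.one_le_size] at hd2
  obtain ⟨δ, e1, e2⟩ := exists_comp_of_dvd (e.symm.trans h) (hε ▸ Nat.gcd_dvd_right _ _)
  rw [e1, isConst_comp_iff] at hγ
  obtain rfl : δ = one := by
    by_contra hδ
    exact hβ' ⟨δ, ε, hδ, hγ.2, e2⟩
  rw [one_comp] at e2
  subst e2
  obtain ⟨δ, e1, e2⟩ := exists_comp_of_dvd h.symm (hε ▸ Nat.gcd_dvd_left _ _)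
  rw [e1, isConst_comp_iff] at hκ'
  exact ⟨δ, hκ'.2, e2⟩

theorem exists_left_factor {α : Compn} (h : α ≠ one) :
    ∃ f β, f ≠ one ∧ f.OnlyTrivialFactorisations ∧ α = comp f β := by
  induction hn : α.size using Nat.strong_induction_on generalizing α with
  | _ n ih =>
    by_cases hα : α.OnlyTrivialFactorisations
    · exact ⟨α, one, h, hα, (comp_one α).symm⟩
    · simp only [OnlyTrivialFactorisations, not_forall] at hα
      obtain ⟨β, γ, rfl, hnt⟩ := hα
      rw [isTrivialPair_iff, not_or, not_or] at hnt
      have hβ := β.one_le_size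
      have hlt : β.size < n := by
        have h1 := hnt.2.1
        have h2 := γ.one_le_size
        rw [eq_one_iff] at h1
        have : β.size * 2 ≤ β.size * γ.size := Nat.mul_le_mul_left _ (by omega)
        rw [← hn, size_comp]
        omega
      obtain ⟨f, δ, h1, h2, rfl⟩ := ih _ hlt hnt.1 rfl
      exact ⟨f, comp δ γ, h1, h2, comp_assoc _ _ _⟩

theorem exists_maximal_const_left {b : Bool} {α : Compn} (h : α.HasConstLeft b) :
    ∃ κ β, κ ≠ one ∧ κ.IsConst b ∧ ¬ β.HasConstLeft b ∧ α = comp κ β := by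
  obtain ⟨κ, β, h1, h2, rfl⟩ := h
  induction hn : β.size using Nat.strong_induction_on generalizing κ β with
  | _ n ih =>
    by_cases hβ : β.HasConstLeft b
    · obtain ⟨κ', γ, h3, h4, rfl⟩ := hβ
      rw [← comp_assoc]
      refine ih γ.size ?_ (comp κ κ') γ (comp_ne_one_left h1) ((isConst_comp_iff _ _ _).2 ⟨h2, h4⟩)
        rfl
      have hγ := γ.one_le_size
      have := κ'.one_le_size
      rw [Ne, eq_one_iff] at h3
      have : 2 * γ.size ≤ κ'.size * γ.size := Nat.mul_le_mul_right _ (by omega)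
      rw [← hn, size_comp]
      omega
    · exact ⟨κ, β, h1, h2, hβ, rfl⟩

theorem const_left_inj {b : Bool} {κ β κ' β' : Compn} (hκ : κ.IsConst b) (hκ' : κ'.IsConst b)
    (hβ : ¬ β.HasConstLeft b) (hβ' : ¬ β'.HasConstLeft b) (h : comp κ β = comp κ' β') :
    κ = κ' ∧ β = β' := by
  obtain ⟨δ, hδ, rfl⟩ := exists_comp_of_not_hasConstLeft hκ hκ' hβ' h
  obtain rfl : δ = one := by
    by_contra h1
    exact hβ ⟨δ, β', h1, hδ, rfl⟩
  exact comp_inj_of_size_eq h (by rw [one_comp])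

/-! ### Irreducible factorisations and normalised compositions -/

theorem IsSymmetric.isLexMinimal {α : Compn} (h : α.IsSymmetric) : α.IsLexMinimal := by
  rw [IsLexMinimal, ← h]

theorem IsConst.isSymmetric {b : Bool} {α : Compn} (h : α.IsConst b) : α.IsSymmetric := by
  refine h.unique (fun i hi => ?_) (size_reversal α).symm
  rw [size_reversal] at hi
  have hα := α.one_le_size
  obtain ⟨c, hc⟩ := Nat.exists_eq_add_of_le hα
  have hd : α.size ∣ i + c * i := ⟨i, by rw [hc]; ring⟩
  rw [isCut_reversal α hd]
  exact h _ fun h' => hi ((Nat.dvd_add_left h').1 hd)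

theorem OnlyTrivialFactorisations.isNormalised {f : Compn} (hf : f.OnlyTrivialFactorisations)
    (h : f.IsLexMinimal) : f.IsNormalised :=
  ⟨[f], ⟨by simp, by simp [comp_one], by simp, by simpa using hf⟩, by simpa using h⟩

theorem IsConst.isNormalised {b : Bool} {α : Compn} (h : α.IsConst b) : α.IsNormalised :=
  h.onlyTrivialFactorisations.isNormalised h.isSymmetric.isLexMinimal

namespace IsIrreducibleFactorisation

variable {f g α : Compn} {t : List Compn}

theorem eq_comp (h : IsIrreducibleFactorisation (f :: t) α) : α = comp f (t.foldr comp one) :=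
  h.2.1

theorem onlyTrivial (h : IsIrreducibleFactorisation (f :: t) α) : f.OnlyTrivialFactorisations :=
  h.2.2.2 f (by simp)

/-- A factor (1) makes any adjacent pair trivial, so it can only stand alone. -/
theorem head_ne_one (h : IsIrreducibleFactorisation (f :: t) α) (hα : α ≠ one) : f ≠ one := by
  rintro rfl
  cases t with
  | nil => exact hα (by rw [h.eq_comp]; exact comp_one _)
  | cons g t =>
    have := h.2.2.1
    rw [List.isChain_cons_cons] at this
    exact this.1 (Or.inl (Or.inl rfl))

theorem tail (h : IsIrreducibleFactorisation (f :: g :: t) α) :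
    IsIrreducibleFactorisation (g :: t) ((g :: t).foldr comp one) :=
  ⟨by simp, rfl, (List.isChain_cons_cons.1 h.2.2.1).2,
    fun β hβ => h.2.2.2 β (List.mem_cons_of_mem _ hβ)⟩

theorem head_isConst {b : Bool} (h : IsIrreducibleFactorisation (f :: t) α)
    (hα : α.HasConstLeft b) : f.IsConst b := by
  have hf1 := h.head_ne_one (by rintro rfl; exact not_hasConstLeft_one b hα)
  rcases h.onlyTrivial.isIrreducible_or with hf | ⟨b', hf⟩
  · exact absurd (h.eq_comp ▸ hα) (hf.not_hasConstLeft b)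
  · obtain rfl := hα.unique ⟨f, _, hf1, hf, h.eq_comp⟩
    exact hf

/-- Otherwise the next factor would be constant of the same kind as `f`, giving a trivial adjacent
pair. Thus a constant head is automatically maximal. -/
theorem not_hasConstLeft_tail {b : Bool} (h : IsIrreducibleFactorisation (f :: t) α)
    (hf : f.IsConst b) : ¬ (t.foldr comp one).HasConstLeft b := by
  intro h'
  cases t with
  | nil => exact not_hasConstLeft_one b h'
  | cons g t =>
    exact (List.isChain_cons_cons.1 h.2.2.1).1
      ((isTrivialPair_iff _ _).2 (Or.inr (Or.inr ⟨b, hf, h.tail.head_isConst h'⟩)))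

theorem cons {β : Compn} (h : IsIrreducibleFactorisation (g :: t) β)
    (hf : f.OnlyTrivialFactorisations) (hfg : ¬ IsTrivialPair f g) :
    IsIrreducibleFactorisation (f :: g :: t) (comp f β) :=
  ⟨by simp, by rw [h.2.1]; rfl, List.isChain_cons_cons.2 ⟨hfg, h.2.2.1⟩, by
    intro x hx
    rcases List.mem_cons.1 hx with rfl | hx
    · exact hf
    · exact h.2.2.2 x hx⟩

end IsIrreducibleFactorisation

theorem IsNormalised.exists_comp {α : Compn} (h : α.IsNormalised) (hα : α ≠ one) :
    ∃ f β, f ≠ one ∧ f.OnlyTrivialFactorisations ∧ f.IsLexMinimal ∧ β.IsNormalised ∧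
      (∀ b, f.IsConst b → ¬ β.HasConstLeft b) ∧ α = comp f β := by
  obtain ⟨fs, h, hmin⟩ := h
  obtain ⟨f, t, rfl⟩ := List.exists_cons_of_ne_nil h.1
  refine ⟨f, t.foldr comp one, h.head_ne_one hα, h.onlyTrivial, hmin f (by simp), ?_,
    fun b hb => h.not_hasConstLeft_tail hb, h.eq_comp⟩
  cases t with
  | nil => exact (isConst_of_eq_one true rfl).isNormalised
  | cons g t => exact ⟨_, h.tail, fun x hx => hmin x (List.mem_cons_of_mem _ hx)⟩

theorem IsNormalised.comp_left {f β : Compn} (hf : f.OnlyTrivialFactorisations)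
    (hmin : f.IsLexMinimal) (h : β.IsNormalised)
    (hfβ : ∀ b, f.IsConst b → ¬ β.HasConstLeft b) : (comp f β).IsNormalised := by
  by_cases hf1 : f = one
  · rwa [hf1, one_comp]
  by_cases hβ : β = one
  · rw [hβ, comp_one]
    exact hf.isNormalised hmin
  obtain ⟨fs, h, hmin'⟩ := h
  obtain ⟨g, t, rfl⟩ := List.exists_cons_of_ne_nil h.1
  have hg1 := h.head_ne_one hβ
  refine ⟨f :: g :: t, h.cons hf fun ht => ?_, ?_⟩
  · rcases (isTrivialPair_iff _ _).1 ht with ht | ht | ⟨b, h1, h2⟩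
    · exact hf1 ht
    · exact hg1 ht
    · exact hfβ b h1 ⟨g, _, hg1, h2, h.eq_comp⟩
  · intro x hx
    rcases List.mem_cons.1 hx with rfl | hx
    · exact hmin
    · exact hmin' x hx

/-! ### Multiplicative classes of compositions -/

/-- Membership in `X` is determined by the factors of an irreducible factorisation. -/
structure IsMultiplicative (X : Set Compn) : Prop where
  const : ∀ {b : Bool} {α : Compn}, α.IsConst b → α ∈ X
  comp_irreducible : ∀ {π β : Compn}, π.IsIrreducible → (comp π β ∈ X ↔ π ∈ X ∧ β ∈ X)
  comp_const : ∀ {b : Bool} {κ β : Compn}, κ.IsConst b → (comp κ β ∈ X ↔ β ∈ X)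

theorem isSymmetric_comp_iff (α β : Compn) :
    (comp α β).IsSymmetric ↔ α.IsSymmetric ∧ β.IsSymmetric := by
  rw [IsSymmetric, reversal_comp]
  constructor
  · intro h
    exact comp_inj_of_size_eq h (size_reversal β).symm
  · rintro ⟨h, h'⟩
    rw [← h, ← h']

theorem isMultiplicative_isSymmetric : IsMultiplicative {α | α.IsSymmetric} where
  const h := h.isSymmetric
  comp_irreducible _ := isSymmetric_comp_iff _ _
  comp_const h := (isSymmetric_comp_iff _ _).trans (and_iff_right h.isSymmetric)

theorem IsIrreducible.isNormalised_comp_iff {π β : Compn} (hπ : π.IsIrreducible) :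
    (comp π β).IsNormalised ↔ π.IsLexMinimal ∧ β.IsNormalised := by
  constructor
  · intro h
    obtain ⟨f, γ, hf1, hf, hmin, hγ, -, e⟩ := h.exists_comp (comp_ne_one_left hπ.ne_one)
    obtain ⟨rfl, rfl⟩ := hπ.comp_inj hf hf1 e
    exact ⟨hmin, hγ⟩
  · rintro ⟨h, h'⟩
    exact h'.comp_left hπ.2.2 h fun b hb => absurd hb (((isIrreducible_iff _).1 hπ).1 b)

theorem IsIrreducible.isNormalised_iff {π : Compn} (hπ : π.IsIrreducible) :
    π.IsNormalised ↔ π.IsLexMinimal := by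
  have := hπ.isNormalised_comp_iff (β := one)
  rwa [comp_one, and_iff_left (isConst_of_eq_one true rfl).isNormalised] at this

/-- Here κ may merge with a constant head of β, so it need not be a factor of the irreducible
factorisation. Both directions therefore pass through the maximal constant head, and constants,
being symmetric, never obstruct lexicographic minimality. -/
theorem IsConst.isNormalised_comp_iff {b : Bool} {κ β : Compn} (hκ : κ.IsConst b) :
    (comp κ β).IsNormalised ↔ β.IsNormalised := by
  have hmin : ∀ {δ : Compn}, δ.IsConst b → δ.IsLexMinimal := fun h => h.isSymmetric.isLexMinimal
  have hcomp : ∀ {δ γ : Compn}, δ.IsConst b → γ.IsNormalised → ¬ γ.HasConstLeft b →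
      (comp δ γ).IsNormalised := by
    intro δ γ hδ hγ hn
    by_cases hδ1 : δ = one
    · rwa [hδ1, one_comp]
    refine hγ.comp_left hδ.onlyTrivialFactorisations (hmin hδ) fun b' hb' => ?_
    cases b <;> cases b'
    · exact hn
    · exact absurd (hδ.eq_one hb') hδ1
    · exact absurd (hb'.eq_one hδ) hδ1
    · exact hn
  by_cases hκ1 : κ = one
  · rw [hκ1, one_comp]
  constructor
  · intro h
    obtain ⟨f, γ, hf1, hf, -, hγ, hn, e⟩ := h.exists_comp (comp_ne_one_left hκ1)
    have hc : (comp κ β).HasConstLeft b := ⟨κ, β, hκ1, hκ, rfl⟩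
    rcases hf.isIrreducible_or with hf | ⟨b', hf⟩
    · exact absurd (e ▸ hc) (hf.not_hasConstLeft b)
    · obtain rfl := hc.unique ⟨f, γ, hf1, hf, e⟩
      obtain ⟨δ, hδ, rfl⟩ := exists_comp_of_not_hasConstLeft hκ hf (hn b hf) e
      exact hcomp hδ hγ (hn b hf)
  · intro h
    by_cases hβ : β.HasConstLeft b
    · have hβ1 : β ≠ one := by
        rintro rfl
        exact not_hasConstLeft_one b hβ
      obtain ⟨f, γ, hf1, hf, -, hγ, hn, rfl⟩ := h.exists_comp hβ1
      rcases hf.isIrreducible_or with hf | ⟨b', hf⟩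
      · exact absurd hβ (hf.not_hasConstLeft b)
      · obtain rfl := hβ.unique ⟨f, γ, hf1, hf, rfl⟩
        rw [← comp_assoc]
        exact hcomp ((isConst_comp_iff _ _ _).2 ⟨hκ, hf⟩) hγ (hn b hf)
    · exact hcomp hκ h hβ

theorem isMultiplicative_isNormalised : IsMultiplicative {α | α.IsNormalised} where
  const h := h.isNormalised
  comp_irreducible h := h.isNormalised_comp_iff.trans (and_congr_left' h.isNormalised_iff.symm)
  comp_const h := h.isNormalised_comp_iff

/-! ### Dirichlet generating functions -/

theorem dgf_apply (A : Set Compn) (n : ℕ) :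
    dgf A n = ({α : Compn | α ∈ A ∧ α.size = n}.ncard : ℤ) := rfl

theorem finite_mem_size_eq (A : Set Compn) (n : ℕ) : {α : Compn | α ∈ A ∧ α.size = n}.Finite :=
  (finite_size_eq n).subset fun _ h => h.2

theorem dgf_union {A B : Set Compn} (h : Disjoint A B) : dgf (A ∪ B) = dgf A + dgf B := by
  ext n
  rw [ArithmeticFunction.add_apply, dgf_apply, dgf_apply, dgf_apply, ← Nat.cast_add,
    ← Set.ncard_union_eq _ (finite_mem_size_eq A n) (finite_mem_size_eq B n)]
  · congr 2
    ext α
    simp only [Set.mem_union, Set.mem_ofPred_eq]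
    tauto
  · rw [Set.disjoint_left] at h ⊢
    exact fun α h1 h2 => h h1.1 h2.1

/-- Sizes multiply under composition, so unique factorisation through A and B becomes Dirichlet
convolution. -/
theorem dgf_mul {A B C : Set Compn} (hmem : ∀ α ∈ A, ∀ β ∈ B, comp α β ∈ C)
    (hsurj : ∀ γ ∈ C, ∃ α ∈ A, ∃ β ∈ B, γ = comp α β)
    (hinj : ∀ α ∈ A, ∀ β ∈ B, ∀ α' ∈ A, ∀ β' ∈ B, comp α β = comp α' β' → α = α' ∧ β = β') :
    dgf C = dgf A * dgf B := by
  classical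
  ext n
  rcases Nat.eq_zero_or_pos n with rfl | hn
  · simp
  rw [ArithmeticFunction.mul_apply]
  simp only [dgf_apply]
  simp only [Set.ncard_eq_toFinset_card _ (finite_mem_size_eq _ _), ← Nat.cast_mul,
    ← Finset.card_product, ← Nat.cast_sum]
  rw [← Finset.card_sigma]
  norm_cast
  symm
  refine Finset.card_bij (fun x _ => comp x.2.1 x.2.2) ?_ ?_ ?_
  · rintro ⟨⟨d, e⟩, α, β⟩ h
    simp only [Finset.mem_sigma, Nat.mem_divisorsAntidiagonal, Finset.mem_product,
      Set.Finite.mem_toFinset, Set.mem_ofPred_eq] at h ⊢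
    exact ⟨hmem _ h.2.1.1 _ h.2.2.1, by rw [size_comp, h.2.1.2, h.2.2.2, h.1.1]⟩
  · rintro ⟨⟨d, e⟩, α, β⟩ h ⟨⟨d', e'⟩, α', β'⟩ h' he
    simp only [Finset.mem_sigma, Nat.mem_divisorsAntidiagonal, Finset.mem_product,
      Set.Finite.mem_toFinset, Set.mem_ofPred_eq] at h h'
    obtain ⟨rfl, rfl⟩ := hinj _ h.2.1.1 _ h.2.2.1 _ h'.2.1.1 _ h'.2.2.1 he
    obtain ⟨-, ⟨-, rfl⟩, -, rfl⟩ := h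
    obtain ⟨-, ⟨-, rfl⟩, -, rfl⟩ := h'
    rfl
  · intro γ hγ
    simp only [Set.Finite.mem_toFinset, Set.mem_ofPred_eq] at hγ
    obtain ⟨α, hα, β, hβ, rfl⟩ := hsurj γ hγ.1
    refine ⟨⟨⟨α.size, β.size⟩, α, β⟩, ?_, rfl⟩
    simp only [Finset.mem_sigma, Nat.mem_divisorsAntidiagonal, Finset.mem_product,
      Set.Finite.mem_toFinset, Set.mem_ofPred_eq]
    exact ⟨⟨by rw [← size_comp, hγ.2], by omega⟩, ⟨hα, trivial⟩, hβ, trivial⟩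

theorem dgf_singleton_one : dgf {one} = 1 := by
  ext n
  rw [dgf_apply, ArithmeticFunction.one_apply]
  have h1 : one.size = 1 := rfl
  split_ifs with h
  · rw [show {α : Compn | α ∈ ({one} : Set Compn) ∧ α.size = n} = {one} by
      ext α
      simp only [Set.mem_singleton_iff, Set.mem_ofPred_eq, and_iff_left_iff_imp]
      rintro rfl
      rw [h1, h]]
    simp
  · rw [show {α : Compn | α ∈ ({one} : Set Compn) ∧ α.size = n} = ∅ by
      ext α
      simp only [Set.mem_singleton_iff, Set.mem_ofPred_eq, Set.mem_empty_iff_false, iff_false]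
      rintro ⟨rfl, h'⟩
      exact h (h'.symm.trans h1)]
    simp

theorem dgf_isConst (b : Bool) :
    dgf {α | α.IsConst b} = (ArithmeticFunction.zeta : ArithmeticFunction ℤ) := by
  ext n
  rcases Nat.eq_zero_or_pos n with rfl | hn
  · simp
  obtain ⟨α, hα, hα'⟩ := exists_isConst b hn
  rw [dgf_apply, show {β : Compn | β ∈ {α : Compn | α.IsConst b} ∧ β.size = n} = {α} by
    ext β
    simp only [Set.mem_singleton_iff, Set.mem_ofPred_eq]
    constructor
    · exact fun h => h.1.unique hα' (h.2.trans hα.symm)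
    · rintro rfl
      exact ⟨hα', hα⟩]
  simp [ArithmeticFunction.natCoe_apply, ArithmeticFunction.zeta_apply, hn.ne']

theorem dgf_isConst_ne_one (b : Bool) :
    dgf {α | α ≠ one ∧ α.IsConst b} = (ArithmeticFunction.zeta : ArithmeticFunction ℤ) - 1 := by
  rw [eq_sub_iff_add_eq, ← dgf_isConst b, ← dgf_singleton_one, ← dgf_union]
  · congr 1
    ext α
    simp only [Set.mem_union, Set.mem_singleton_iff, Set.mem_ofPred_eq]
    constructor
    · rintro (h | h)
      · exact h.2
      · exact isConst_of_eq_one b h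
    · intro h
      by_cases h1 : α = one
      · exact Or.inr h1
      · exact Or.inl ⟨h1, h⟩
  · rw [Set.disjoint_left]
    exact fun α h h' => h.1 h'

namespace IsMultiplicative

variable {X : Set Compn}

/-- Splitting off the maximal constant is a bijection onto pairs of a constant ≠ (1) and a member of
X without constant left factor of that kind; the identity is this product formula with the
complement eliminated. -/
theorem dgf_hasConstLeft (hX : IsMultiplicative X) (b : Bool) :
    (ArithmeticFunction.zeta : ArithmeticFunction ℤ) * dgf {α | α ∈ X ∧ α.HasConstLeft b} =
      ((ArithmeticFunction.zeta : ArithmeticFunction ℤ) - 1) * dgf X := by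
  have h1 : dgf X = dgf {α | α ∈ X ∧ α.HasConstLeft b} + dgf {α | α ∈ X ∧ ¬ α.HasConstLeft b} := by
    rw [← dgf_union]
    · congr 1
      ext α
      simp only [Set.mem_union, Set.mem_ofPred_eq]
      tauto
    · rw [Set.disjoint_left]
      exact fun α h h' => h'.2 h.2
  have h2 : dgf {α | α ∈ X ∧ α.HasConstLeft b} =
      dgf {α | α ≠ one ∧ α.IsConst b} * dgf {α | α ∈ X ∧ ¬ α.HasConstLeft b} := by
    refine dgf_mul ?_ ?_ ?_
    · rintro κ ⟨h1, h2⟩ β ⟨h3, h4⟩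
      exact ⟨(hX.comp_const h2).2 h3, κ, β, h1, h2, rfl⟩
    · rintro α ⟨h1, h2⟩
      obtain ⟨κ, β, h3, h4, h5, rfl⟩ := exists_maximal_const_left h2
      exact ⟨κ, ⟨h3, h4⟩, β, ⟨(hX.comp_const h4).1 h1, h5⟩, rfl⟩
    · rintro κ ⟨-, h1⟩ β ⟨-, h2⟩ κ' ⟨-, h1'⟩ β' ⟨-, h2'⟩ e
      exact const_left_inj h1 h1' h2 h2' e
  rw [dgf_isConst_ne_one] at h2
  linear_combination ((ArithmeticFunction.zeta : ArithmeticFunction ℤ) - 1) * (-h1) + h2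

theorem dgf_irreducible_left (hX : IsMultiplicative X) :
    dgf {α | α ∈ X ∧ ∃ π β, IsIrreducible π ∧ α = comp π β} =
      dgf {π | π.IsIrreducible ∧ π ∈ X} * dgf X := by
  refine dgf_mul ?_ ?_ ?_
  · rintro π ⟨h1, h2⟩ β h3
    exact ⟨(hX.comp_irreducible h1).2 ⟨h2, h3⟩, π, β, h1, rfl⟩
  · rintro α ⟨h1, π, β, h2, rfl⟩
    have := (hX.comp_irreducible h2).1 h1
    exact ⟨π, ⟨h2, this.1⟩, β, this.2, rfl⟩
  · rintro π ⟨h1, -⟩ β - π' ⟨h2, -⟩ β' - e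
    exact h1.comp_inj h2.2.2 h2.ne_one e

/-- A composition other than (1) has a leftmost factor that is irreducible, of length 1 or all ones,
and these cases exclude each other. -/
theorem dgf_eq (hX : IsMultiplicative X) :
    dgf X = 1 + dgf {α | α ∈ X ∧ α.HasConstLeft false} + dgf {α | α ∈ X ∧ α.HasConstLeft true} +
      dgf {π | π.IsIrreducible ∧ π ∈ X} * dgf X := by
  rw [← hX.dgf_irreducible_left, ← dgf_singleton_one, ← dgf_union, ← dgf_union, ← dgf_union]
  · congr 1
    ext α
    simp only [Set.mem_union, Set.mem_singleton_iff, Set.mem_ofPred_eq, ← and_or_left, or_assoc]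
    constructor
    · intro h
      by_cases h1 : α = one
      · exact Or.inl h1
      refine Or.inr ⟨h, ?_⟩
      obtain ⟨f, β, hf1, hf, e⟩ := exists_left_factor h1
      rcases hf.isIrreducible_or with hf | ⟨b, hf⟩
      · exact Or.inr (Or.inr ⟨f, β, hf, e⟩)
      · cases b
        · exact Or.inl ⟨f, β, hf1, hf, e⟩
        · exact Or.inr (Or.inl ⟨f, β, hf1, hf, e⟩)
    · rintro (rfl | h)
      · exact hX.const (isConst_of_eq_one true rfl)
      · exact h.1
  · rw [Set.disjoint_left]
    rintro α ((rfl | ⟨-, h⟩) | ⟨-, h⟩) ⟨-, π, β, h1, e⟩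
    · exact comp_ne_one_left h1.ne_one e.symm
    · exact h1.not_hasConstLeft _ (e ▸ h)
    · exact h1.not_hasConstLeft _ (e ▸ h)
  · rw [Set.disjoint_left]
    rintro α (rfl | ⟨-, h⟩) ⟨-, h'⟩
    · exact not_hasConstLeft_one _ h'
    · exact Bool.false_ne_true (h.unique h')
  · rw [Set.disjoint_left]
    rintro α rfl ⟨-, h'⟩
    exact not_hasConstLeft_one _ h'

theorem isUnit_zeta : IsUnit (ArithmeticFunction.zeta : ArithmeticFunction ℤ) :=
  IsUnit.of_mul_eq_one _ ArithmeticFunction.coe_zeta_mul_moebius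

theorem dgf_mul_eq_one (hX : IsMultiplicative X) :
    dgf X * (2 * Ring.inverse (ArithmeticFunction.zeta : ArithmeticFunction ℤ) - 1 -
      dgf {π | π.IsIrreducible ∧ π ∈ X}) = 1 := by
  have h := hX.dgf_eq
  have h0 := hX.dgf_hasConstLeft false
  have h1 := hX.dgf_hasConstLeft true
  have hz := Ring.inverse_mul_cancel _ isUnit_zeta
  generalize (ArithmeticFunction.zeta : ArithmeticFunction ℤ) = z at *
  generalize dgf {α | α ∈ X ∧ α.HasConstLeft false} = X0 at *
  generalize dgf {α | α ∈ X ∧ α.HasConstLeft true} = X1 at *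
  generalize dgf {π | π.IsIrreducible ∧ π ∈ X} = p at *
  generalize dgf X = x at *
  generalize Ring.inverse z = y at *
  linear_combination h + y * (h0 + h1) + (2 * x - X0 - X1) * hz

theorem isUnit_dgf (hX : IsMultiplicative X) : IsUnit (dgf X) :=
  IsUnit.of_mul_eq_one _ hX.dgf_mul_eq_one

theorem dgf_irreducible (hX : IsMultiplicative X) : dgf {π | π.IsIrreducible ∧ π ∈ X} =
    2 * Ring.inverse (ArithmeticFunction.zeta : ArithmeticFunction ℤ) - 1 -
      Ring.inverse (dgf X) := by
  have h := hX.dgf_mul_eq_one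
  have h' := Ring.inverse_mul_cancel _ hX.isUnit_dgf
  linear_combination Ring.inverse (dgf X) * (-h) -
    (dgf {π | π.IsIrreducible ∧ π ∈ X} -
      2 * Ring.inverse (ArithmeticFunction.zeta : ArithmeticFunction ℤ) + 1) * h'

end IsMultiplicative

/-! ### Counting symmetric compositions -/

/-- Symmetry means that the cuts are invariant under i ↦ n - i, so they are determined by an
arbitrary subset of 1, …, ⌊n/2⌋. -/
theorem dgf_isSymmetric_apply {n : ℕ} (hn : 1 ≤ n) :
    dgf {α | α.IsSymmetric} n = 2 ^ (n / 2) := by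
  classical
  rw [dgf_apply, Set.ncard_eq_toFinset_card _ (finite_mem_size_eq _ _)]
  have : (Finset.Icc 1 (n / 2)).powerset.card = 2 ^ (n / 2) := by simp
  rw [← Nat.cast_ofNat, ← Nat.cast_pow, ← this]
  norm_cast
  have hsym : ∀ α : Compn, α.IsSymmetric → α.size = n → ∀ i, i ≤ n →
      (α.IsCut i ↔ α.IsCut (n - i)) := by
    intro α h hs i hi
    conv_lhs => rw [h]
    exact isCut_reversal α (by rw [hs, Nat.add_sub_cancel' hi])
  refine Finset.card_bij (fun α _ => (Finset.Icc 1 (n / 2)).filter α.IsCut) ?_ ?_ ?_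
  · intro α _
    exact Finset.mem_powerset.2 (Finset.filter_subset _ _)
  · intro α h β h' e
    simp only [Set.Finite.mem_toFinset, Set.mem_ofPred_eq] at h h'
    have key : ∀ i, 1 ≤ i → i ≤ n / 2 → (α.IsCut i ↔ β.IsCut i) := by
      intro i h1 h2
      have := Finset.ext_iff.1 e i
      simpa [h1, h2] using this
    refine ext_isCut (h.2.trans h'.2.symm) fun i hi => ?_
    rw [h.2] at hi
    have hlt := Nat.mod_lt i hn
    have hne : i % n ≠ 0 := fun h => hi (Nat.dvd_of_mod_eq_zero h)
    rw [α.isCut_congr (j := i % n) (h.2 ▸ (Nat.mod_modEq i n).symm),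
      β.isCut_congr (j := i % n) (h'.2 ▸ (Nat.mod_modEq i n).symm)]
    by_cases hle : i % n ≤ n / 2
    · exact key _ (by omega) hle
    · rw [hsym α h.1 h.2 _ hlt.le, hsym β h'.1 h'.2 _ hlt.le]
      exact key _ (by omega) (by omega)
  · intro s hs
    rw [Finset.mem_powerset] at hs
    obtain ⟨α, hα, hα'⟩ := exists_isCut_iff hn fun i => i ∈ s ∨ n - i ∈ s
    have hα2 : ∀ i, 0 < i → i < n → (α.IsCut i ↔ i ∈ s ∨ n - i ∈ s) := by
      intro i h1 h2
      rw [hα' i (Nat.not_dvd_of_pos_of_lt h1 h2), Nat.mod_eq_of_lt h2]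
    refine ⟨α, ?_, ?_⟩
    · simp only [Set.Finite.mem_toFinset, Set.mem_ofPred_eq]
      refine ⟨ext_isCut (size_reversal α).symm fun i hi => ?_, hα⟩
      rw [hα] at hi
      have hlt := Nat.mod_lt i hn
      have hne : i % n ≠ 0 := fun h => hi (Nat.dvd_of_mod_eq_zero h)
      have hmod : i ≡ i % n [MOD n] := (Nat.mod_modEq i n).symm
      rw [α.isCut_congr (j := i % n) (hα.symm ▸ hmod),
        α.reversal.isCut_congr (j := i % n) ((α.size_reversal.trans hα).symm ▸ hmod),
        isCut_reversal α (j := n - i % n) (by rw [hα, Nat.add_sub_cancel' hlt.le]),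
        hα2 _ (by omega) hlt, hα2 _ (by omega) (by omega), Nat.sub_sub_self hlt.le, or_comm]
    · ext i
      rw [Finset.mem_filter, Finset.mem_Icc]
      constructor
      · rintro ⟨⟨h1, h2⟩, h3⟩
        rw [hα2 i (by omega) (by omega)] at h3
        rcases h3 with h3 | h3
        · exact h3
        -- Both i and n - i are at most n/2, so i is the midpoint and the reflection adds nothing to
        -- the lower half.
        · have := Finset.mem_Icc.1 (hs h3)
          rwa [show n - i = i by omega] at h3
      · intro h
        have := Finset.mem_Icc.1 (hs h)
        refine ⟨this, ?_⟩
        rw [hα2 i (by omega) (by omega)]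
        exact Or.inl h

end Compn

/-! ### The three formulas -/

theorem mainTheorem2
    (P Psym Pasym R S ζ : ArithmeticFunction ℤ)
    (hP : P = Compn.dgf {α | α.IsIrreducible ∧ α.IsNormalised})
    (hPsym : Psym = Compn.dgf {α | α.IsIrreducible ∧ α.IsSymmetric})
    (hPasym : Pasym = Compn.dgf {α | α.IsIrreducible ∧ α.IsNormalised ∧ ¬ α.IsSymmetric})
    (hR : R = Compn.dgf {α | α.IsNormalised})
    (hS : S = Compn.dgf {α | α.IsSymmetric})
    (hζ : ζ = (ArithmeticFunction.zeta : ArithmeticFunction ℤ)) :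
    (∀ n : ℕ, 1 ≤ n → S n = 2 ^ (n / 2)) ∧
    (IsUnit ζ ∧ IsUnit R ∧ IsUnit S) ∧
    P = 2 * Ring.inverse ζ - 1 - Ring.inverse R ∧
    Psym = 2 * Ring.inverse ζ - 1 - Ring.inverse S ∧
    Pasym = Ring.inverse S - Ring.inverse R := by
  subst hP hPsym hPasym hR hS hζ
  have hN := Compn.isMultiplicative_isNormalised
  have hS := Compn.isMultiplicative_isSymmetric
  refine ⟨fun n => Compn.dgf_isSymmetric_apply,
    ⟨Compn.IsMultiplicative.isUnit_zeta, hN.isUnit_dgf, hS.isUnit_dgf⟩,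
    hN.dgf_irreducible, hS.dgf_irreducible, ?_⟩
  -- A symmetric irreducible composition is lexicographic minimal, hence normalised, so P = P^× +
  -- P^* and the last formula is a difference of the first two.
  have h : Compn.dgf {α | α.IsIrreducible ∧ α.IsNormalised} =
      Compn.dgf {α | α.IsIrreducible ∧ α.IsNormalised ∧ ¬ α.IsSymmetric} +
        Compn.dgf {α | α.IsIrreducible ∧ α.IsSymmetric} := by
    rw [← Compn.dgf_union]
    · congr 1
      ext α
      have : α.IsIrreducible → α.IsSymmetric → α.IsNormalised := fun h h' =>
        h.isNormalised_iff.2 h'.isLexMinimal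
      simp only [Set.mem_union, Set.mem_ofPred_eq]
      tauto
    · rw [Set.disjoint_left]
      exact fun α h h' => h.2.2 h'.2
  have h1 := hN.dgf_irreducible
  have h2 := hS.dgf_irreducible
  simp only [Set.mem_ofPred_eq] at h1 h2
  linear_combination h1 - h2 - h
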